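/- Let $n_k,T_k$ be positive integers, $k\in\mathbb N$, with $n_k\to\infty$, $T_k\to\infty$ and $n_k/T_k\to r<1$ as $k\to\infty$. For each $k$ let $\Sigma_k$ be a (real symmetric) positive definite $n_k\times n_k$ matrix, and let $Y_k$ be a random $T_k\times n_k$ matrix whose rows are independent $N(0,\Sigma_k)$ vectors (the centered returns of $n_k$ assets at $T_k$ successive times). Let $$\widehat\Sigma_k=\frac{1}{T_k}\,Y_k^{t}Y_k$$ be the maximum likelihood estimator of $\Sigma_k$, that is, the estimator $\frac{1}{\operatorname{Tr}(B)}Y_k^{t}BY_k$ with $B=I_{T_k}$. For an invertible $n\times n$ covariance matrix $S$ let $w(S)$ be the vector of optimal portfolio weights $$w(S)_i=\frac{\sum_{j}(S^{-1})_{ij}}{\sum_{j,l}(S^{-1})_{jl}},$$ and put $$Q_k=\frac{(\text{True risk})^2}{(\text{Predicted risk})^2},\qquad \text{True risk}=\sqrt{w(\Sigma_k)^{t}\,\Sigma_k\, w(\Sigma_k)},\qquad \text{Predicted risk}=\sqrt{w(\widehat\Sigma_k)^{t}\,\widehat\Sigma_k\, w(\widehat\Sigma_k)},$$ which is almost surely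 well defined when $T_k\ge n_k$, hence for all large $k$. Then $Q_k\to \frac{1}{1-r}$ in probability, i.e. for every $\varepsilon>0$, $$\Pr\left(\left|Q_k-\tfrac{1}{1-r}\right|\ge\varepsilon\right)\longrightarrow 0\qquad (k\to\infty).$$ -/

import Mathlib

open MeasureTheory ProbabilityTheory Filter Topology
open scoped Matrix

noncomputable section

namespace Portfolio

/-- The weights `ω i = (∑ j, σ⁻¹ i j) / (∑ j k, σ⁻¹ j k)` of the portfolio that minimizes
`wᵗ S w` under the constraint `∑ i, w i = 1`, determined by the entries of the inverse of the
(true or estimated) covariance matrix `S`. -/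
def optimalWeights {n : ℕ} (S : Matrix (Fin n) (Fin n) ℝ) : Fin n → ℝ :=
  fun i => (∑ j, S⁻¹ i j) / (∑ j, ∑ k, S⁻¹ j k)

/-- The risk `√(wᵗ S w)` of the portfolio whose weights `w` are the optimal weights determined
by `S`. For the covariance matrix `Σ` of the returns this is the true risk, for an estimator of
`Σ` this is the predicted risk. -/
def optimalRisk {n : ℕ} (S : Matrix (Fin n) (Fin n) ℝ) : ℝ :=
  √(optimalWeights S ⬝ᵥ (S *ᵥ optimalWeights S))

/-- The ratio `Q = (True risk)² / (Predicted risk)²` for the covariance matrix `S` and its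
estimate `Shat`. -/
def riskRatio {n : ℕ} (S Shat : Matrix (Fin n) (Fin n) ℝ) : ℝ :=
  optimalRisk S ^ 2 / optimalRisk Shat ^ 2

/-- The estimator `(1 / Tr B) Yᵗ B Y` of the covariance matrix of `n` assets, for the matrix `Y`
whose `T` rows are the observed vectors of centered returns, with weighting matrix `B`. -/
def covEstimator {T n : ℕ} (B : Matrix (Fin T) (Fin T) ℝ) (Y : Matrix (Fin T) (Fin n) ℝ) :
    Matrix (Fin n) (Fin n) ℝ :=
  (1 / B.trace) • (Yᵀ * B * Y)

/-- The maximum likelihood estimator of the covariance matrix: the weighting matrix is the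
identity, so this is `(1 / T) Yᵗ Y`. -/
def mleEstimator {T n : ℕ} (Y : Matrix (Fin T) (Fin n) ℝ) : Matrix (Fin n) (Fin n) ℝ :=
  covEstimator (1 : Matrix (Fin T) (Fin T) ℝ) Y

/-- Convergence in probability to a real constant `c` of real random variables `Z k`, each of
which may live on its own probability space `(Ω k, P k)`. -/
def TendstoInProbability {Ω : ℕ → Type*} [∀ k, MeasurableSpace (Ω k)]
    (P : ∀ k, Measure (Ω k)) (Z : ∀ k, Ω k → ℝ) (c : ℝ) : Prop :=
  ∀ ε : ℝ, 0 < ε → Tendsto (fun k => P k {ω | ε ≤ |Z k ω - c|}) atTop (𝓝 0)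

end Portfolio

end

/-! Let `w` be the true optimal weights and `s` the true risk. Since `S w = s² 1`, the return `w ·
y` of the optimal portfolio is uncorrelated with the excess returns `y - (w · y) 1`, hence
independent of them by joint Gaussianity (`map_excessDecomposition`). So the observations are `R + s
x 1ᵗ` with `R w = 0` and `x` standard Gaussian in `ℝ^T`, independent of `R`.

Minimizing `‖(R + s x 1ᵗ) v‖` over weights `v` of sum 1 gives the distance from `s x` to the range
of `R`, so `T` times the squared predicted risk is `s²` times the squared norm of a projection of
`x` (`card_mul_optimalRisk_mleEstimator_sq`). Given `R`, that squared norm is chi-squared with `T -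
rank R` degrees of freedom, where `rank R` is `n` up to an error of 1. Chebyshev gives
predicted²/true² ≈ `(T - n) / T`, which tends to `1 - r`; inverting gives the claim. The bound does
not depend on `S`. -/

namespace Portfolio

/-! ### Predicted risk as a distance to a subspace -/

section LinearAlgebra

variable {n T : ℕ}

lemma sum_inv_pos {S : Matrix (Fin n) (Fin n) ℝ} (hS : S.PosDef) (hn : 0 < n) :
    0 < ∑ j, ∑ k, S⁻¹ j k := by
  have h1 : (1 : Fin n → ℝ) ≠ 0 := by
    intro h
    simpa using congrFun h ⟨0, hn⟩
  have h := hS.inv.dotProduct_mulVec_pos h1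
  simpa [dotProduct, Matrix.mulVec] using h

lemma optimalWeights_eq_smul (S : Matrix (Fin n) (Fin n) ℝ) :
    optimalWeights S = (∑ j, ∑ k, S⁻¹ j k)⁻¹ • (S⁻¹ *ᵥ 1) := by
  ext i
  simp [optimalWeights, Matrix.mulVec, dotProduct, div_eq_inv_mul]

lemma sum_optimalWeights {S : Matrix (Fin n) (Fin n) ℝ} (hS : S.PosDef) (hn : 0 < n) :
    ∑ i, optimalWeights S i = 1 := by
  simp only [optimalWeights]
  rw [← Finset.sum_div]
  exact div_self (sum_inv_pos hS hn).ne'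

/-- The first-order condition of the constrained minimization. It yields both the orthogonality to
the range of `R` (for the estimate) and the independence of the excess returns (for the true
covariance). -/
lemma mulVec_optimalWeights {S : Matrix (Fin n) (Fin n) ℝ} (hS : S.PosDef) :
    S *ᵥ optimalWeights S = fun _ => (∑ j, ∑ k, S⁻¹ j k)⁻¹ := by
  have hdet : IsUnit S.det := (Matrix.isUnit_iff_isUnit_det S).mp hS.isUnit
  rw [optimalWeights_eq_smul, Matrix.mulVec_smul, Matrix.mulVec_mulVec,
    Matrix.mul_nonsing_inv _ hdet, Matrix.one_mulVec]
  ext i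
  simp

lemma optimalWeights_dotProduct_mulVec {S : Matrix (Fin n) (Fin n) ℝ} (hS : S.PosDef)
    (hn : 0 < n) :
    optimalWeights S ⬝ᵥ (S *ᵥ optimalWeights S) = (∑ j, ∑ k, S⁻¹ j k)⁻¹ := by
  rw [mulVec_optimalWeights hS]
  simp only [dotProduct]
  rw [← Finset.sum_mul, sum_optimalWeights hS hn, one_mul]

lemma optimalRisk_sq {S : Matrix (Fin n) (Fin n) ℝ} (hS : S.PosDef) (hn : 0 < n) :
    optimalRisk S ^ 2 = (∑ j, ∑ k, S⁻¹ j k)⁻¹ := by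
  have h := optimalWeights_dotProduct_mulVec hS hn
  rw [optimalRisk, h, Real.sq_sqrt (inv_pos.mpr (sum_inv_pos hS hn)).le]

lemma optimalRisk_sq_pos {S : Matrix (Fin n) (Fin n) ℝ} (hS : S.PosDef) (hn : 0 < n) :
    0 < optimalRisk S ^ 2 := by
  rw [optimalRisk_sq hS hn]
  exact inv_pos.mpr (sum_inv_pos hS hn)

lemma mleEstimator_eq (A : Matrix (Fin T) (Fin n) ℝ) :
    mleEstimator A = (1 / (T : ℝ)) • (Aᵀ * A) := by
  simp [mleEstimator, covEstimator]

lemma posDef_mleEstimator {A : Matrix (Fin T) (Fin n) ℝ} (hT : 0 < T)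
    (hA : (Aᵀ * A).det ≠ 0) : (mleEstimator A).PosDef := by
  rw [mleEstimator_eq]
  have h : (Aᵀ * A).PosSemidef := by
    simpa using Matrix.posSemidef_conjTranspose_mul_self A
  exact (h.posDef_iff_det_ne_zero.mpr hA).smul (by positivity)

lemma mulVec_injective_of_det_ne_zero {A : Matrix (Fin T) (Fin n) ℝ}
    (hA : (Aᵀ * A).det ≠ 0) : Function.Injective A.mulVec := by
  have h : Function.Injective (Aᵀ * A).mulVec :=
    Matrix.mulVec_injective_iff_isUnit.mpr
      ((Matrix.isUnit_iff_isUnit_det _).mpr (isUnit_iff_ne_zero.mpr hA))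
  intro u v huv
  apply h
  simp only [← Matrix.mulVec_mulVec]
  exact congrArg _ huv

lemma det_ne_zero_of_mulVec_injective {A : Matrix (Fin T) (Fin n) ℝ}
    (hA : Function.Injective A.mulVec) : (Aᵀ * A).det ≠ 0 := by
  have h : (Aᵀ * A).PosDef := by
    simpa using Matrix.PosDef.conjTranspose_mul_self A hA
  exact h.det_pos.ne'

/-- The range of a matrix, as a subspace of Euclidean space. -/
def colSpace (R : Matrix (Fin T) (Fin n) ℝ) : Submodule ℝ (EuclideanSpace ℝ (Fin T)) :=
  R.mulVecLin.range.map (WithLp.linearEquiv 2 ℝ (Fin T → ℝ)).symm.toLinearMap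

lemma mem_colSpace {R : Matrix (Fin T) (Fin n) ℝ} {x : EuclideanSpace ℝ (Fin T)} :
    x ∈ colSpace R ↔ ∃ u, WithLp.toLp 2 (R *ᵥ u) = x := by
  simp only [colSpace, Submodule.mem_map, LinearMap.mem_range, Matrix.mulVecLin_apply,
    exists_exists_eq_and]
  rfl

lemma mulVec_add_vecMulVec_one (R : Matrix (Fin T) (Fin n) ℝ) (x : Fin T → ℝ) (u : Fin n → ℝ) :
    (R + Matrix.vecMulVec x 1) *ᵥ u = R *ᵥ u + (∑ i, u i) • x := by
  ext i
  rw [Matrix.add_mulVec, Matrix.vecMulVec_mulVec]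
  simp [dotProduct, mul_comm]

/-- On the kernel of `R` the injective matrix `R + x 1ᵗ` acts as `u ↦ (∑ u) x`, so this kernel is at
most a line. -/
lemma finrank_colSpace {R : Matrix (Fin T) (Fin n) ℝ} {x : Fin T → ℝ} {w : Fin n → ℝ}
    (hRw : R *ᵥ w = 0) (hw : ∑ i, w i = 1)
    (hA : Function.Injective (R + Matrix.vecMulVec x 1).mulVec) :
    Module.finrank ℝ (colSpace R) ≤ n ∧ n ≤ Module.finrank ℝ (colSpace R) + 1 := by
  have h1 : Module.finrank ℝ (colSpace R) = Module.finrank ℝ R.mulVecLin.range :=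
    LinearEquiv.finrank_map_eq _ _
  have h2 := R.mulVecLin.finrank_range_add_finrank_ker
  rw [Module.finrank_fin_fun] at h2
  have h3 : Module.finrank ℝ R.mulVecLin.ker ≤ 1 := by
    refine finrank_le_one ⟨w, by simpa using hRw⟩ ?_
    rintro ⟨u, hu⟩
    have hu' : R *ᵥ u = 0 := by simpa using hu
    refine ⟨∑ i, u i, Subtype.ext (hA ?_)⟩
    simp only [SetLike.mk_smul_mk]
    rw [mulVec_add_vecMulVec_one, mulVec_add_vecMulVec_one, Matrix.mulVec_smul, hRw, hu']
    simp [← Finset.mul_sum, hw]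
  omega

/-- If `A = R + x 1ᵗ`, where `R w = 0` for some weights `w`, the predicted risk for the observations
`A` is, up to normalization, the distance of `x` to the range of `R`. -/
lemma card_mul_optimalRisk_mleEstimator_sq {R : Matrix (Fin T) (Fin n) ℝ} {x : Fin T → ℝ}
    {w : Fin n → ℝ} (hn : 0 < n) (hT : 0 < T) (hRw : R *ᵥ w = 0) (hw : ∑ i, w i = 1)
    (hA : ((R + Matrix.vecMulVec x 1)ᵀ * (R + Matrix.vecMulVec x 1)).det ≠ 0) :
    T * optimalRisk (mleEstimator (R + Matrix.vecMulVec x 1)) ^ 2 =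
      ‖(colSpace R)ᗮ.starProjection (WithLp.toLp 2 x)‖ ^ 2 := by
  set A := R + Matrix.vecMulVec x 1 with hAdef
  have hT' : (T : ℝ) ≠ 0 := by positivity
  have hM := posDef_mleEstimator hT hA
  set M := mleEstimator A with hMdef
  set v := optimalWeights M
  have hAM : Aᵀ * A = (T : ℝ) • M := by
    rw [hMdef, mleEstimator_eq, smul_smul, mul_one_div_cancel hT', one_smul]
  have hdot : ∀ u : Fin n → ℝ, (A *ᵥ u) ⬝ᵥ (A *ᵥ v) = T * (u ⬝ᵥ (M *ᵥ v)) := by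
    intro u
    rw [← Matrix.vecMul_transpose, ← Matrix.dotProduct_mulVec, Matrix.mulVec_mulVec, hAM,
      Matrix.smul_mulVec, dotProduct_smul, smul_eq_mul]
  have hv : ∑ i, v i = 1 := sum_optimalWeights hM hn
  have hAv : A *ᵥ v = R *ᵥ v + x := by
    rw [hAdef, mulVec_add_vecMulVec_one, hv, one_smul]
  have hAw : A *ᵥ w = x := by
    rw [hAdef, mulVec_add_vecMulVec_one, hw, one_smul, hRw, zero_add]
  -- `R u` is the image under `A` of a vector of sum zero, which is orthogonal to the constant
  -- vector `M v`.
  have horth : ∀ u, (R *ᵥ u) ⬝ᵥ (A *ᵥ v) = 0 := by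
    intro u
    have hu : R *ᵥ u = A *ᵥ (u - (∑ i, u i) • w) := by
      rw [Matrix.mulVec_sub, Matrix.mulVec_smul, hAw, hAdef, mulVec_add_vecMulVec_one]
      simp
    rw [hu, hdot, mulVec_optimalWeights hM]
    simp only [dotProduct, ← Finset.sum_mul]
    simp [← Finset.mul_sum, hw]
  have hproj : (colSpace R)ᗮ.starProjection (WithLp.toLp 2 x) = WithLp.toLp 2 (A *ᵥ v) := by
    apply Submodule.eq_starProjection_of_mem_orthogonal' (z := WithLp.toLp 2 (-(R *ᵥ v)))
    · rw [Submodule.mem_orthogonal]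
      intro y hy
      obtain ⟨u, rfl⟩ := mem_colSpace.mp hy
      simpa [EuclideanSpace.inner_toLp_toLp, dotProduct_comm] using horth u
    · apply Submodule.le_orthogonal_orthogonal
      exact mem_colSpace.mpr ⟨-v, by rw [Matrix.mulVec_neg]⟩
    · rw [hAv, ← WithLp.toLp_add]
      congr 1
      abel
  rw [hproj, optimalRisk_sq hM hn, ← optimalWeights_dotProduct_mulVec hM hn, ← hdot,
    ← real_inner_self_eq_norm_sq, EuclideanSpace.inner_toLp_toLp]
  simp [v]

end LinearAlgebra

/-! ### Concentration of chi-squared variables -/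

section Chebyshev

variable {E : Type*} [NormedAddCommGroup E] [InnerProductSpace ℝ E] [FiniteDimensional ℝ E]
  [MeasurableSpace E] [BorelSpace E]

/-- For `t` in `K`, pairing with `t` does not see the projection, so the characteristic functions
agree. -/
lemma map_orthogonalProjection_stdGaussian (K : Submodule ℝ E) :
    (stdGaussian E).map K.orthogonalProjectionOnto = stdGaussian K := by
  apply Measure.ext_of_charFun
  ext t
  rw [charFun_stdGaussian, charFun_apply, integral_map (by fun_prop) (by fun_prop)]
  simp only [Submodule.inner_orthogonalProjectionOnto_eq_of_mem_right]
  exact charFun_stdGaussian (t : E)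

lemma memLp_sq_gaussianReal : MemLp (fun x : ℝ => x ^ 2) 2 (gaussianReal 0 1) := by
  rw [memLp_two_iff_integrable_sq (by fun_prop)]
  have h := (memLp_id_gaussianReal (μ := 0) (v := 1) 4).integrable_norm_pow (p := 4) (by simp)
  refine h.congr (ae_of_all _ fun x => ?_)
  simp only [id, Real.norm_eq_abs]
  rw [show (4 : ℕ) = 2 * 2 from rfl, pow_mul, sq_abs]

lemma integral_sq_gaussianReal : ∫ x, x ^ 2 ∂(gaussianReal 0 1) = 1 := by
  have h := variance_id_gaussianReal (μ := 0) (v := 1)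
  rw [variance_of_integral_eq_zero (by fun_prop) (by simp)] at h
  simpa using h

/-- Chebyshev's inequality for the squared norm of a standard Gaussian vector projected onto a
subspace. -/
lemma stdGaussian_norm_starProjection_sq_le (K : Submodule ℝ E) {c : ℝ} (hc : 0 < c) :
    stdGaussian E {x | c ≤ |‖K.starProjection x‖ ^ 2 - Module.finrank ℝ K|} ≤
      ENNReal.ofReal (Module.finrank ℝ K * Var[fun x => x ^ 2; gaussianReal 0 1] / c ^ 2) := by
  set d := Module.finrank ℝ K
  set ν : Measure (Fin d → ℝ) := Measure.pi fun _ => gaussianReal 0 1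
  set b := stdOrthonormalBasis ℝ K
  set g : Fin d → (Fin d → ℝ) → ℝ := fun i x => x i ^ 2
  have hg : ∀ i, MemLp (g i) 2 ν := fun i =>
    memLp_sq_gaussianReal.comp_measurePreserving
      (measurePreserving_eval (fun _ : Fin d => gaussianReal 0 1) i)
  have hmean : ∫ x, (∑ i, g i) x ∂ν = (d : ℝ) := by
    simp only [Finset.sum_apply]
    rw [integral_finsetSum _ fun i _ => (hg i).integrable (by norm_num)]
    have : ∀ i, ∫ x, g i x ∂ν = 1 := fun i => by
      rw [← integral_sq_gaussianReal]
      exact integral_comp_eval (μ := fun _ : Fin d => gaussianReal 0 1) (i := i)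
        (f := fun x : ℝ => x ^ 2) (by fun_prop)
    simp [this]
  have hvar : Var[∑ i, g i; ν] = d * Var[fun x => x ^ 2; gaussianReal 0 1] := by
    have := variance_sum_pi (μ := fun _ : Fin d => gaussianReal 0 1)
      (X := fun _ x => x ^ 2) fun _ => memLp_sq_gaussianReal
    simpa using this
  have hnorm : ∀ x : Fin d → ℝ, ‖∑ i, x i • b i‖ ^ 2 = (∑ i, g i) x := fun x => by
    rw [← b.equiv_apply_euclideanSpace (WithLp.toLp 2 x), LinearIsometryEquiv.norm_map,
      EuclideanSpace.real_norm_sq_eq]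
    simp only [g, Finset.sum_apply]
    rfl
  have hcheb := meas_ge_le_variance_div_sq (memLp_finsetSum' Finset.univ fun i _ => hg i) hc
  rw [hmean, hvar] at hcheb
  refine le_trans (le_of_eq ?_) hcheb
  have hmeas : MeasurableSet {y : K | c ≤ |‖y‖ ^ 2 - d|} :=
    measurableSet_le measurable_const (by fun_prop)
  calc stdGaussian E {x | c ≤ |‖K.starProjection x‖ ^ 2 - d|}
      = (stdGaussian E).map K.orthogonalProjectionOnto {y : K | c ≤ |‖y‖ ^ 2 - d|} := by
        rw [Measure.map_apply (by fun_prop) hmeas]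
        rfl
    _ = ν {x | c ≤ |(∑ i, g i) x - d|} := by
        rw [map_orthogonalProjection_stdGaussian, stdGaussian,
          Measure.map_apply (Measurable.mono (by fun_prop) le_rfl le_rfl) hmeas]
        simp only [Set.preimage_ofPred_eq, ← hnorm]
        rfl

end Chebyshev

end Portfolio

namespace Portfolio

open scoped RealInnerProductSpace

/-! ### Gaussian rows: almost sure full rank and independence -/

section GaussianRows

variable {n T : ℕ}

lemma inner_multivariateGaussian {S : Matrix (Fin n) (Fin n) ℝ} (hS : S.PosSemidef)
    (c : EuclideanSpace ℝ (Fin n)) :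
    (multivariateGaussian 0 S).map (fun y => ⟪c, y⟫) =
      gaussianReal 0 (c ⬝ᵥ S *ᵥ c).toNNReal := by
  have h := IsGaussian.map_eq_gaussianReal (μ := multivariateGaussian 0 S) (innerSL ℝ c)
  have h1 : (multivariateGaussian 0 S)[innerSL ℝ c] = 0 := by
    rw [(innerSL ℝ c).integral_comp_id_comm IsGaussian.integrable_id,
      integral_id_multivariateGaussian, map_zero]
  have h2 : Var[innerSL ℝ c; multivariateGaussian 0 S] = c ⬝ᵥ S *ᵥ c := by
    rw [← covarianceBilin_multivariateGaussian (μ := 0) hS,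
      covarianceBilin_self IsGaussian.memLp_two_id]
    rfl
  rw [h1, h2] at h
  exact h

/-- A proper subspace lies in a hyperplane `c⊥`, and `⟪c, y⟫` is Gaussian with positive variance,
hence has no atom at 0. -/
lemma multivariateGaussian_submodule_eq_zero {S : Matrix (Fin n) (Fin n) ℝ} (hS : S.PosDef)
    {K : Submodule ℝ (EuclideanSpace ℝ (Fin n))} (hK : K ≠ ⊤) :
    multivariateGaussian 0 S K = 0 := by
  obtain ⟨c, hcK, hc⟩ := Submodule.exists_mem_ne_zero_of_ne_bot
    (mt Submodule.orthogonal_eq_bot_iff.mp hK)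
  have hpos : 0 < c ⬝ᵥ S *ᵥ c := by
    have h := hS.dotProduct_mulVec_pos (x := c.ofLp) (by simpa using hc)
    simpa using h
  have hv : (c ⬝ᵥ S *ᵥ c).toNNReal ≠ 0 := by simpa using hpos
  have := nullSingletonClass_gaussianReal (μ := 0) hv
  refine measure_mono_null (t := (fun y => ⟪c, y⟫) ⁻¹' {0}) (fun y hy => ?_) ?_
  · exact (Submodule.mem_orthogonal' K c).mp hcK y hy
  · rw [← Measure.map_apply (by fun_prop) (measurableSet_singleton 0),
      inner_multivariateGaussian hS.posSemidef]
    exact measure_singleton 0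

/-- Independent samples of a measure that does not charge proper subspaces are almost surely
linearly independent, as long as there are no more of them than the dimension. -/
lemma ae_linearIndependent_pi {E : Type*} [NormedAddCommGroup E] [NormedSpace ℝ E]
    [FiniteDimensional ℝ E] [MeasurableSpace E] [BorelSpace E] {μ : Measure E}
    [IsProbabilityMeasure μ] (hμ : ∀ K : Submodule ℝ E, K ≠ ⊤ → μ K = 0) (m : ℕ)
    (hm : m ≤ Module.finrank ℝ E) :
    ∀ᵐ y ∂(Measure.pi fun _ : Fin m => μ), LinearIndependent ℝ y := by
  induction m with
  | zero => exact ae_of_all _ fun y => linearIndependent_empty_type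
  | succ m ih =>
    have hmeas : MeasurableSet {y : Fin (m + 1) → E | ¬ LinearIndependent ℝ y} :=
      isOpen_setOfPred_linearIndependent.measurableSet.compl
    have hmp := (measurePreserving_piFinSuccAbove (fun _ : Fin (m + 1) => μ) 0).symm
    rw [ae_iff, ← hmp.measure_preimage hmeas.nullMeasurableSet,
      Measure.prod_apply_symm (hmp.measurable hmeas), lintegral_eq_zero_iff
        (measurable_measure_prodMk_right (hmp.measurable hmeas))]
    -- With the other `m` vectors fixed, dependence forces the new one into their span, which is
    -- proper because `m` is less than the dimension.
    filter_upwards [ih (by omega)] with y hy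
    have hK : Submodule.span ℝ (Set.range y) ≠ ⊤ := by
      intro h
      have h1 := finrank_range_le_card (R := ℝ) y
      rw [Set.finrank, h, finrank_top, Fintype.card_fin] at h1
      omega
    refine measure_mono_null (fun a ha => ?_) (hμ _ hK)
    by_contra hna
    refine ha ?_
    have h := linearIndependent_finCons.mpr ⟨hy, hna⟩
    rwa [← Fin.insertNth_zero'] at h

/-- The first `n` of the `T` rows almost surely span `ℝ^n`, so a vector killed by the matrix is
orthogonal to everything. -/
lemma ae_det_ne_zero {S : Matrix (Fin n) (Fin n) ℝ} (hS : S.PosDef) (hnT : n ≤ T) :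
    ∀ᵐ y ∂(Measure.pi fun _ : Fin T => multivariateGaussian 0 S),
      ((Matrix.of fun i j => y i j)ᵀ * (Matrix.of fun i j => y i j) :
        Matrix (Fin n) (Fin n) ℝ).det ≠ 0 := by
  set μ := multivariateGaussian 0 S
  have hind : iIndepFun (fun i (y : Fin T → EuclideanSpace ℝ (Fin n)) => y i)
      (Measure.pi fun _ => μ) := iIndepFun_pi (X := fun _ => id) fun _ => aemeasurable_id
  have hmap := (hind.precomp (Fin.castLE_injective hnT)).map_fun_eq_pi_map fun i =>
    (measurable_pi_apply _).aemeasurable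
  have hmarg : ∀ i : Fin T, (Measure.pi fun _ : Fin T => μ).map (fun y => y i) = μ := fun i =>
    (measurePreserving_eval (fun _ : Fin T => μ) i).map_eq
  simp only [hmarg] at hmap
  have h := ae_linearIndependent_pi (μ := μ)
    (fun K hK => multivariateGaussian_submodule_eq_zero hS hK) n (by simp)
  rw [← hmap] at h
  filter_upwards [ae_of_ae_map (measurable_pi_lambda _ fun i =>
    measurable_pi_apply _).aemeasurable h] with y hy
  apply det_ne_zero_of_mulVec_injective
  rw [← Matrix.coe_mulVecLin, injective_iff_map_eq_zero]
  intro u hu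
  have hspan := hy.span_eq_top_of_card_eq_finrank' (by simp)
  have hmem : WithLp.toLp 2 u ∈ (⊤ : Submodule ℝ (EuclideanSpace ℝ (Fin n)))ᗮ := by
    rw [← hspan, Submodule.mem_orthogonal]
    intro v hv
    induction hv using Submodule.span_induction with
    | mem v hv =>
      obtain ⟨i, rfl⟩ := hv
      have := congrFun hu (Fin.castLE hnT i)
      simpa [Matrix.mulVec, dotProduct, PiLp.inner_apply, mul_comm] using this
    | zero => simp
    | add v v' _ _ hv hv' => rw [inner_add_left, hv, hv', add_zero]
    | smul a v _ hv => rw [inner_smul_left, hv, mul_zero]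
  simpa using hmem

/-- The decomposition of a vector of returns into the normalized return of the optimal portfolio
and the excess returns of the assets over that portfolio. -/
noncomputable def excessDecomposition (S : Matrix (Fin n) (Fin n) ℝ) (y : EuclideanSpace ℝ (Fin n)) :
    ℝ × EuclideanSpace ℝ (Fin n) :=
  ((optimalRisk S)⁻¹ * ⟪WithLp.toLp 2 (optimalWeights S), y⟫,
    y - ⟪WithLp.toLp 2 (optimalWeights S), y⟫ • WithLp.toLp 2 1)

lemma measurable_excessDecomposition (S : Matrix (Fin n) (Fin n) ℝ) :
    Measurable (excessDecomposition S) := by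
  unfold excessDecomposition
  fun_prop

/-- The normalized return of the optimal portfolio is standard Gaussian and independent of the
excess returns. -/
lemma map_excessDecomposition {S : Matrix (Fin n) (Fin n) ℝ} (hS : S.PosDef) (hn : 0 < n) :
    (multivariateGaussian 0 S).map (excessDecomposition S) =
      (gaussianReal 0 1).prod
        ((multivariateGaussian 0 S).map fun y => (excessDecomposition S y).2) := by
  set μ := multivariateGaussian 0 S
  set w : EuclideanSpace ℝ (Fin n) := WithLp.toLp 2 (optimalWeights S) with hw
  set s := optimalRisk S with hs
  have hs2 : s ^ 2 = optimalWeights S ⬝ᵥ (S *ᵥ optimalWeights S) := by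
    rw [optimalRisk_sq hS hn, optimalWeights_dotProduct_mulVec hS hn]
  have hspos : 0 < s ^ 2 := optimalRisk_sq_pos hS hn
  have hs0 : s ≠ 0 := by
    intro h
    simp [h] at hspos
  have hfst : μ.map (fun y => (excessDecomposition S y).1) = gaussianReal 0 1 := by
    have h : (fun y => (excessDecomposition S y).1) =
        fun y => ⟪s⁻¹ • w, y⟫ := by
      ext y
      rw [real_inner_smul_left]
      rfl
    rw [h, inner_multivariateGaussian hS.posSemidef]
    congr 1
    rw [WithLp.ofLp_smul, Matrix.mulVec_smul, smul_dotProduct, dotProduct_smul, hw, ← hs2]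
    simp only [smul_eq_mul]
    rw [show s⁻¹ * (s⁻¹ * s ^ 2) = 1 by field_simp, Real.toNNReal_one]
  let L : EuclideanSpace ℝ (Fin n) →L[ℝ] ℝ × EuclideanSpace ℝ (Fin n) :=
    (s⁻¹ • innerSL ℝ w).prod
      (ContinuousLinearMap.id ℝ _ - (innerSL ℝ w).smulRight (WithLp.toLp 2 1))
  have hgauss : HasGaussianLaw (fun y => ((excessDecomposition S y).1,
      (excessDecomposition S y).2)) μ :=
    (IsGaussian.hasGaussianLaw_id (μ := μ)).map L
  have hcov : ∀ (a : ℝ) (u : EuclideanSpace ℝ (Fin n)),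
      cov[fun y => ⟪a, (excessDecomposition S y).1⟫,
        fun y => ⟪u, (excessDecomposition S y).2⟫; μ] = 0 := by
    intro a u
    have h1 : (fun y => ⟪a, (excessDecomposition S y).1⟫) = fun y => ⟪(a * s⁻¹) • w, y⟫ := by
      ext y
      rw [real_inner_smul_left]
      simp [excessDecomposition, hw, hs]
      ring
    have h2 : (fun y => ⟪u, (excessDecomposition S y).2⟫) =
        fun y => ⟪u - ⟪u, WithLp.toLp 2 1⟫ • w, y⟫ := by
      ext y
      rw [inner_sub_left, real_inner_smul_left]
      simp only [excessDecomposition, inner_sub_right, real_inner_smul_right]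
      ring
    -- As `S w = s² 1`, the covariance is a multiple of `⟪u, 1⟫ s² - ⟪u, 1⟫ s²`.
    rw [h1, h2, ← covarianceBilin_apply_eq_cov IsGaussian.memLp_two_id,
      covarianceBilin_multivariateGaussian hS.posSemidef, WithLp.ofLp_smul, WithLp.ofLp_sub,
      WithLp.ofLp_smul, Matrix.mulVec_sub, Matrix.mulVec_smul, smul_dotProduct, dotProduct_sub,
      dotProduct_smul, hw, ← hs2, Matrix.dotProduct_mulVec, ← Matrix.mulVec_transpose,
      show Sᵀ = S by simpa using hS.isHermitian.eq, mulVec_optimalWeights hS,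
      ← optimalRisk_sq hS hn, ← hs]
    simp [dotProduct, PiLp.inner_apply, ← Finset.mul_sum, mul_comm]
  have hindep := hgauss.indepFun_of_covariance_inner hcov
  have hmeas := measurable_excessDecomposition S
  have h := hindep.map_prod_eq_prod_map_map (by fun_prop) (by fun_prop)
  rw [hfst] at h
  exact h

lemma map_pi_prod {ι α β γ : Type*} [Fintype ι] [MeasurableSpace α] [MeasurableSpace β]
    [MeasurableSpace γ] {μ : Measure α} [IsProbabilityMeasure μ] {ν : Measure β}
    {ρ : Measure γ} [IsProbabilityMeasure ν] [IsProbabilityMeasure ρ] {φ : α → β × γ}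
    (hφ : Measurable φ) (h : μ.map φ = ν.prod ρ) :
    (Measure.pi fun _ : ι => μ).map (fun y => (fun i => (φ (y i)).1, fun i => (φ (y i)).2)) =
      (Measure.pi fun _ : ι => ν).prod (Measure.pi fun _ : ι => ρ) := by
  rw [← (measurePreserving_arrowProdEquivProdArrow β γ ι (fun _ => ν) (fun _ => ρ)).map_eq]
  simp only [← h]
  have := Measure.isProbabilityMeasure_map (μ := μ) hφ.aemeasurable
  rw [← Measure.pi_map_pi fun _ => hφ.aemeasurable, Measure.map_map (by fun_prop) (by fun_prop)]
  rfl

end GaussianRows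

end Portfolio

namespace Portfolio

/-! ### Measurability of the risks, for Fubini -/

section Measurability

variable {α : Type*} [MeasurableSpace α] {n T : ℕ}

lemma measurable_det {M : α → Matrix (Fin n) (Fin n) ℝ} (hM : ∀ i j, Measurable fun a => M a i j) :
    Measurable fun a => (M a).det := by
  simp only [Matrix.det_apply]
  fun_prop

lemma measurable_inv_apply {M : α → Matrix (Fin n) (Fin n) ℝ}
    (hM : ∀ i j, Measurable fun a => M a i j) (i j : Fin n) :
    Measurable fun a => (M a)⁻¹ i j := by
  simp only [Matrix.inv_def, Matrix.smul_apply, Ring.inverse_eq_inv', smul_eq_mul,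
    Matrix.adjugate_apply]
  refine (measurable_det hM).inv.mul (measurable_det fun k l => ?_)
  simp only [Matrix.updateRow_apply]
  split_ifs
  · exact measurable_const
  · exact hM k l

lemma measurable_optimalRisk {M : α → Matrix (Fin n) (Fin n) ℝ}
    (hM : ∀ i j, Measurable fun a => M a i j) : Measurable fun a => optimalRisk (M a) := by
  have hinv := measurable_inv_apply hM
  have hw : ∀ i, Measurable fun a => optimalWeights (M a) i := fun i =>
    (Finset.measurable_sum _ fun j _ => hinv i j).div
      (Finset.measurable_sum _ fun j _ => Finset.measurable_sum _ fun k _ => hinv j k)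
  have hMw : ∀ i, Measurable fun a => (M a *ᵥ optimalWeights (M a)) i := fun i => by
    simp only [Matrix.mulVec, dotProduct]
    fun_prop
  simp only [optimalRisk, dotProduct]
  fun_prop

lemma measurable_transpose_mul_self_apply {A : α → Matrix (Fin T) (Fin n) ℝ}
    (hA : ∀ i j, Measurable fun a => A a i j) (i j : Fin n) :
    Measurable fun a => ((A a)ᵀ * A a) i j := by
  simp only [Matrix.mul_apply, Matrix.transpose_apply]
  fun_prop

end Measurability

/-! ### Concentration of predicted²/true² by conditioning on the excess returns -/

section Concentration

variable {n T : ℕ}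

/-- The observations reconstructed from the normalized returns of the optimal portfolio and the
excess returns over it. -/
noncomputable def recombine (S : Matrix (Fin n) (Fin n) ℝ)
    (p : (Fin T → ℝ) × (Fin T → EuclideanSpace ℝ (Fin n))) : Matrix (Fin T) (Fin n) ℝ :=
  (Matrix.of fun i j => p.2 i j) + Matrix.vecMulVec (optimalRisk S • p.1) 1

/-- The pairs of normalized optimal returns and excess returns for which the estimated covariance
matrix is invertible, but the ratio of squared risks deviates by at least `δ`. -/
def deviationSet (S : Matrix (Fin n) (Fin n) ℝ) (T : ℕ) (δ : ℝ) :
    Set ((Fin T → ℝ) × (Fin T → EuclideanSpace ℝ (Fin n))) :=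
  {p | (Matrix.of fun i j => p.2 i j) *ᵥ optimalWeights S = 0 ∧
    ((recombine S p)ᵀ * recombine S p).det ≠ 0 ∧
    δ ≤ |optimalRisk (mleEstimator (recombine S p)) ^ 2 / optimalRisk S ^ 2 - (T - n) / T|}

lemma measurableSet_deviationSet (S : Matrix (Fin n) (Fin n) ℝ) (δ : ℝ) :
    MeasurableSet (deviationSet S T δ) := by
  have h1 : ∀ i j, Measurable fun p : (Fin T → ℝ) × (Fin T → EuclideanSpace ℝ (Fin n)) =>
      recombine S p i j := by
    intro i j
    simp only [recombine, Matrix.add_apply, Matrix.of_apply, Matrix.vecMulVec_apply,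
      Pi.smul_apply, smul_eq_mul, Pi.one_apply, mul_one]
    fun_prop
  have h2 := measurable_transpose_mul_self_apply h1
  have h3 : ∀ i j, Measurable fun p : (Fin T → ℝ) × (Fin T → EuclideanSpace ℝ (Fin n)) =>
      mleEstimator (recombine S p) i j := by
    intro i j
    simp only [mleEstimator_eq, Matrix.smul_apply]
    exact (h2 i j).const_mul _
  refine MeasurableSet.inter ?_ (MeasurableSet.inter ?_ ?_)
  · refine measurableSet_eq_fun (f := fun p : (Fin T → ℝ) × (Fin T → EuclideanSpace ℝ (Fin n)) =>
      (Matrix.of fun i j => p.2 i j) *ᵥ optimalWeights S) (g := fun _ => 0) ?_ measurable_const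
    refine measurable_pi_lambda _ fun i => ?_
    simp only [Matrix.mulVec, dotProduct, Matrix.of_apply]
    fun_prop
  · exact (measurableSet_eq_fun (measurable_det h2) measurable_const).compl
  · have := measurable_optimalRisk h3
    exact measurableSet_le measurable_const (((this.pow_const 2).div_const _).sub_const _).abs

lemma prod_deviationSet_le {S : Matrix (Fin n) (Fin n) ℝ} (hS : S.PosDef) (hn : 0 < n)
    (hT : 0 < T) {δ : ℝ} (hδ : 0 < δ) (hTδ : 2 ≤ T * δ)
    (ρ : Measure (Fin T → EuclideanSpace ℝ (Fin n))) [IsProbabilityMeasure ρ] :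
    ((Measure.pi fun _ : Fin T => gaussianReal 0 1).prod ρ) (deviationSet S T δ) ≤
      ENNReal.ofReal (4 * Var[fun x => x ^ 2; gaussianReal 0 1] / δ ^ 2 / T) := by
  set V := Var[fun x => x ^ 2; gaussianReal 0 1]
  rw [Measure.prod_apply_symm (measurableSet_deviationSet S δ)]
  refine (lintegral_mono (g := fun _ => ENNReal.ofReal (4 * V / δ ^ 2 / T)) fun R => ?_).trans
    (by simp)
  set B := (fun x => (x, R)) ⁻¹' deviationSet S T δ
  -- A single point of the section at `R` suffices to get `R w = 0` and the rank bounds, which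
  -- concern `R` alone.
  rcases B.eq_empty_or_nonempty with hB | ⟨x₀, hx₀⟩
  · simp [hB]
  set M : Matrix (Fin T) (Fin n) ℝ := Matrix.of fun i j => R i j with hM
  set K := (colSpace M)ᗮ
  set s := optimalRisk S with hs
  have hs2 : 0 < s ^ 2 := optimalRisk_sq_pos hS hn
  have hw := sum_optimalWeights hS hn
  have hT' : (0 : ℝ) < T := by exact_mod_cast hT
  obtain ⟨hR, hd₀, -⟩ := hx₀
  have hrank := finrank_colSpace hR hw (mulVec_injective_of_det_ne_zero hd₀)
  have hdim := (colSpace M).finrank_add_finrank_orthogonal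
  rw [finrank_euclideanSpace, Fintype.card_fin] at hdim
  have hdim' : (Module.finrank ℝ (colSpace M) : ℝ) + Module.finrank ℝ K = T := by
    exact_mod_cast hdim
  have hr1 : (Module.finrank ℝ (colSpace M) : ℝ) ≤ n := by exact_mod_cast hrank.1
  have hr2 : (n : ℝ) ≤ Module.finrank ℝ (colSpace M) + 1 := by exact_mod_cast hrank.2
  have hsub : B ⊆ WithLp.toLp 2 ⁻¹'
      {x | T * δ / 2 ≤ |‖K.starProjection x‖ ^ 2 - Module.finrank ℝ K|} := by
    rintro x ⟨-, hd, hx⟩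
    have hrisk := card_mul_optimalRisk_mleEstimator_sq hn hT hR hw hd
    rw [WithLp.toLp_smul, map_smul, norm_smul, mul_pow, Real.norm_eq_abs, sq_abs] at hrisk
    set a := ‖K.starProjection (WithLp.toLp 2 x)‖ ^ 2
    have hq : optimalRisk (mleEstimator (recombine S (x, R))) ^ 2 / s ^ 2 = a / T := by
      rw [div_eq_div_iff hs2.ne' hT'.ne', mul_comm, mul_comm a]
      exact hrisk
    have hx' : T * δ ≤ |a - (T - n)| := by
      rw [hq, ← sub_div, abs_div, abs_of_pos hT', le_div_iff₀ hT'] at hx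
      linarith
    change T * δ / 2 ≤ |a - Module.finrank ℝ K|
    -- `dim K` lies between `T - n` and `T - n + 1`; the error 1 is at most `T δ / 2` by `hTδ`.
    have h1 : |a - (T - n)| ≤ |a - Module.finrank ℝ K| + 1 := by
      refine (abs_sub_le a (Module.finrank ℝ K) _).trans (add_le_add_right ?_ _)
      rw [abs_le]
      constructor <;> linarith
    linarith
  have hK : MeasurableSet {x : EuclideanSpace ℝ (Fin T) |
      T * δ / 2 ≤ |‖K.starProjection x‖ ^ 2 - Module.finrank ℝ K|} :=
    measurableSet_le measurable_const (by fun_prop)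
  refine (measure_mono hsub).trans ?_
  rw [← Measure.map_apply (by fun_prop) hK, map_pi_eq_stdGaussian]
  refine (stdGaussian_norm_starProjection_sq_le K (by positivity)).trans
    (ENNReal.ofReal_le_ofReal ?_)
  have hV : 0 ≤ V := variance_nonneg _ _
  have hKT : (Module.finrank ℝ K : ℝ) ≤ T := by
    have : (0 : ℝ) ≤ Module.finrank ℝ (colSpace M) := by positivity
    linarith
  calc Module.finrank ℝ K * V / (T * δ / 2) ^ 2 ≤ T * V / (T * δ / 2) ^ 2 := by gcongr
    _ = 4 * V / δ ^ 2 / T := by field_simp; norm_num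

lemma recombine_excessDecomposition {S : Matrix (Fin n) (Fin n) ℝ} (hS : S.PosDef) (hn : 0 < n)
    (y : Fin T → EuclideanSpace ℝ (Fin n)) :
    recombine S (fun i => (excessDecomposition S (y i)).1,
      fun i => (excessDecomposition S (y i)).2) = Matrix.of fun i j => y i j := by
  have hs : optimalRisk S ≠ 0 := fun h => by
    simpa [h] using optimalRisk_sq_pos hS hn
  ext i j
  simp [recombine, excessDecomposition, mul_inv_cancel_left₀ hs]

lemma excess_mulVec_optimalWeights {S : Matrix (Fin n) (Fin n) ℝ} (hS : S.PosDef) (hn : 0 < n)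
    (y : Fin T → EuclideanSpace ℝ (Fin n)) :
    (Matrix.of fun i j => (excessDecomposition S (y i)).2 j) *ᵥ optimalWeights S = 0 := by
  ext i
  have hw := sum_optimalWeights hS hn
  simp [excessDecomposition, Matrix.mulVec, dotProduct, sub_mul, ← Finset.mul_sum, hw,
    PiLp.inner_apply]

/-- The ratio of the squared predicted and true risks concentrates around `(T - n) / T`. -/
lemma pi_deviation_le {S : Matrix (Fin n) (Fin n) ℝ} (hS : S.PosDef) (hn : 0 < n)
    (hT : 0 < T) (hnT : n ≤ T) {δ : ℝ} (hδ : 0 < δ) (hTδ : 2 ≤ T * δ) :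
    (Measure.pi fun _ : Fin T => multivariateGaussian 0 S)
      {y | δ ≤ |optimalRisk (mleEstimator (Matrix.of fun i j => y i j)) ^ 2 / optimalRisk S ^ 2 -
        (T - n) / T|} ≤
      ENNReal.ofReal (4 * Var[fun x => x ^ 2; gaussianReal 0 1] / δ ^ 2 / T) := by
  have hmeas := measurable_excessDecomposition S
  have hprob := Measure.isProbabilityMeasure_map (μ := multivariateGaussian 0 S)
    (f := fun y => (excessDecomposition S y).2) (by fun_prop)
  refine le_trans ?_ (prod_deviationSet_le hS hn hT hδ hTδ (Measure.pi fun _ =>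
    (multivariateGaussian 0 S).map fun y => (excessDecomposition S y).2))
  rw [← map_pi_prod hmeas (map_excessDecomposition hS hn),
    Measure.map_apply (by fun_prop) (measurableSet_deviationSet S δ)]
  refine measure_mono_ae ?_
  filter_upwards [ae_det_ne_zero hS hnT] with y hy hyδ
  refine ⟨excess_mulVec_optimalWeights hS hn y, ?_, ?_⟩
  · rwa [recombine_excessDecomposition hS hn]
  · rwa [recombine_excessDecomposition hS hn]

end Concentration

end Portfolio

/-! ### Passage to the limit -/

theorem corollary4p1
    (r : ℝ) (hr : r < 1)
    -- numbers of assets and of observations along the limit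
    (n T : ℕ → ℕ) (hn : Tendsto n atTop atTop) (hT : Tendsto T atTop atTop)
    (hnT : Tendsto (fun k => (n k : ℝ) / (T k : ℝ)) atTop (𝓝 r))
    -- the true covariance matrices
    (S : ∀ k, Matrix (Fin (n k)) (Fin (n k)) ℝ) (hS : ∀ k, (S k).PosDef)
    -- the returns at the times `1, …, T k`: independent random vectors with law `N(0, S k)`
    {Ω : ℕ → Type*} [∀ k, MeasurableSpace (Ω k)]
    (P : ∀ k, Measure (Ω k)) [∀ k, IsProbabilityMeasure (P k)]
    (Y : ∀ k, Fin (T k) → Ω k → EuclideanSpace ℝ (Fin (n k)))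
    (hlaw : ∀ k i, HasLaw (Y k i) (multivariateGaussian 0 (S k)) (P k))
    (hindep : ∀ k, iIndepFun (Y k) (P k)) :
    Portfolio.TendstoInProbability P
      (fun k ω => Portfolio.riskRatio (S k)
        (Portfolio.mleEstimator (Matrix.of fun i j => Y k i ω j)))
      (1 / (1 - r)) := by
  intro ε hε
  have h1r : 1 - r ≠ 0 := by linarith
  obtain ⟨δ, hδ, hinv⟩ := Metric.continuousAt_iff.mp (continuousAt_inv₀ h1r) ε hε
  have hTR : Tendsto (fun k => (T k : ℝ)) atTop atTop := tendsto_natCast_atTop_atTop.comp hT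
  have hbound : Tendsto (fun k => ENNReal.ofReal
      (4 * Var[fun x => x ^ 2; gaussianReal 0 1] / (δ / 2) ^ 2 / T k)) atTop (𝓝 0) := by
    rw [← ENNReal.ofReal_zero]
    exact ENNReal.tendsto_ofReal (hTR.const_div_atTop _)
  refine tendsto_of_tendsto_of_tendsto_of_le_of_le' tendsto_const_nhds hbound
    (Eventually.of_forall fun _ => zero_le) ?_
  -- Half of `δ` is for the random deviation from `(T - n) / T`, the other half for the distance
  -- from `n / T` to `r`.
  filter_upwards [hn.eventually_gt_atTop 0, hT.eventually_gt_atTop 0, hnT.eventually_lt_const hr,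
    hTR.eventually_ge_atTop (2 / (δ / 2)), Metric.tendsto_nhds.mp hnT (δ / 2) (by positivity)]
    with k hnk hTk hlt hTδ hclose
  have hTk' : (0 : ℝ) < T k := by exact_mod_cast hTk
  have hle : n k ≤ T k := by
    rw [div_lt_one hTk'] at hlt
    exact_mod_cast hlt.le
  rw [div_le_iff₀ (by positivity)] at hTδ
  refine le_trans ?_ (Portfolio.pi_deviation_le (hS k) hnk hTk hle (half_pos hδ) hTδ)
  have hmap := (hindep k).map_fun_eq_pi_map fun i => (hlaw k i).aemeasurable
  simp only [(hlaw k _).map_eq] at hmap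
  rw [← hmap]
  -- This inequality between a measure and its image needs no measurability of the event.
  refine le_trans (measure_mono fun ω hω => ?_)
    (Measure.le_map_apply (aemeasurable_pi_lambda _ fun i => (hlaw k i).aemeasurable) _)
  simp only [Set.mem_preimage, Set.mem_ofPred_eq] at hω ⊢
  by_contra! hcon
  set q := Portfolio.optimalRisk (Portfolio.mleEstimator (Matrix.of fun i j => Y k i ω j)) ^ 2 /
    Portfolio.optimalRisk (S k) ^ 2
  have hq : dist q (1 - r) < δ := by
    rw [Real.dist_eq] at hclose ⊢
    have h1 : q - (1 - r) = (q - (T k - n k) / T k) - ((n k : ℝ) / T k - r) := by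
      field_simp
      ring
    rw [h1]
    exact (abs_sub _ _).trans_lt (by linarith)
  have h2 := hinv hq
  rw [Real.dist_eq, ← one_div (1 - r), inv_div] at h2
  exact absurd hω (not_le.mpr h2)
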